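/- Let $\Bbbk$ be an algebraically closed field of characteristic zero and let $A_x$ be the $\Bbbk$-algebra generated by $x$ and $t$ subject to $tx = xt + x$ (the differential Ore extension $A_h=\Bbbk[x][t;h\,\partial_x]$ with $h=x$). For $r(x)\in\Bbbk[x]$ and $a\in\Bbbk^*$ let $\sigma_{r(x)}$ and $\tau_a$ be the $\Bbbk$-automorphisms of $A_x$ given by $\sigma_{r(x)}(x)=x$, $\sigma_{r(x)}(t)=t+r(x)$ and $\tau_a(x)=ax$, $\tau_a(t)=t$. For $n\ge 1$ let $\mathbb G_n=\{a\in\Bbbk \mid a^n=1\}$ act on the additive group $\Bbbk[x]$ by $a\cdot r(x)=r(ax)$, and regard the semidirect product $\Bbbk[x]\rtimes\mathbb G_n$ as the subgroup $\{\sigma_{r(x)}\circ\tau_a \mid r(x)\in\Bbbk[x],\ a\in\mathbb G_n\}$ of $\mathrm{Aut}(A_x)$, the group of $\Bbbk$-algebra automorphisms of $A_x$. Let $w=\sum_{i=0}^{\ell} w_i(x)t^i\in A_x$ with $\ell\ge 0$, $w_i(x)\in\Bbbk[x]$ and $\deg(w_\ell(x))\ge 1$ (in particular $w\notin\Bbbk$),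 let $s(x)\in\Bbbk[x]$ with $\deg(s)<\deg(x)=1$ (so $s$ is a constant, possibly zero), and let $D=ad_w+\Delta_{s(x)}$, where $ad_w(b)=wb-bw$ and $\Delta_{s(x)}$ is the $\Bbbk$-derivation of $A_x$ with $\Delta_{s(x)}(x)=0$, $\Delta_{s(x)}(t)=s(x)$. Let $\mathrm{Aut}_D(A_x)=\{\rho\in\mathrm{Aut}(A_x) \mid \rho D=D\rho\}$. Then there exists an integer $n\ge 1$ such that $\mathrm{Aut}_D(A_x)\subseteq \Bbbk[x]\rtimes\mathbb G_n$. -/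

import Mathlib

open Polynomial

noncomputable section

namespace DiffOre

/-- A `k`-derivation of a (not necessarily commutative) `k`-algebra `R`. -/
structure AlgDer (k R : Type*) [CommRing k] [Ring R] [Algebra k R] extends R →ₗ[k] R where
  leibniz' : ∀ a b : R, toFun (a * b) = toFun a * b + a * toFun b

namespace AlgDer

variable {k R : Type*} [CommRing k] [Ring R] [Algebra k R]

instance : CoeFun (AlgDer k R) (fun _ => R → R) := ⟨fun D => D.toLinearMap⟩

/-- The pointwise sum of two derivations. -/
instance : Add (AlgDer k R) where
  add D E :=
    { toLinearMap := D.toLinearMap + E.toLinearMap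
      leibniz' := by
        intro a b
        have h1 := D.leibniz' a b
        have h2 := E.leibniz' a b
        simp only [AddHom.toFun_eq_coe, LinearMap.coe_toAddHom, LinearMap.add_apply] at h1 h2 ⊢
        rw [h1, h2]
        noncomm_ring }

/-- The inner derivation `ad_w : b ↦ w b - b w`. -/
def ad (k : Type*) {R : Type*} [CommRing k] [Ring R] [Algebra k R] (w : R) : AlgDer k R where
  toLinearMap := LinearMap.mulLeft k w - LinearMap.mulRight k w
  leibniz' := by
    intro a b
    simp only [AddHom.toFun_eq_coe, LinearMap.coe_toAddHom, LinearMap.sub_apply,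
      LinearMap.mulLeft_apply, LinearMap.mulRight_apply]
    noncomm_ring

/-- The isotropy group of `D`: the `k`-algebra automorphisms `ρ` of `R` with `ρ D = D ρ`. -/
def isotropy (D : AlgDer k R) : Subgroup (R ≃ₐ[k] R) where
  carrier := {ρ | ∀ a : R, ρ (D a) = D (ρ a)}
  one_mem' := fun _ => rfl
  mul_mem' := by
    intro ρ η hρ hη a
    simp only [Set.mem_ofPred_eq] at hρ hη
    rw [AlgEquiv.mul_apply, AlgEquiv.mul_apply, hη, hρ]
  inv_mem' := by
    intro ρ hρ a
    simp only [Set.mem_ofPred_eq] at hρ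
    apply ρ.injective
    rw [hρ]
    change ρ (ρ.symm (D a)) = D (ρ (ρ.symm a))
    rw [ρ.apply_symm_apply, ρ.apply_symm_apply]

end AlgDer

/-- The defining relation `t x = x t + h(x)`; the free generators are `ι 0 = x`, `ι 1 = t`. -/
inductive Rel {k : Type*} [Field k] (h : k[X]) :
    FreeAlgebra k (Fin 2) → FreeAlgebra k (Fin 2) → Prop
  | comm : Rel h (FreeAlgebra.ι k 1 * FreeAlgebra.ι k 0)
      (FreeAlgebra.ι k 0 * FreeAlgebra.ι k 1 + aeval (FreeAlgebra.ι k (0 : Fin 2)) h)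

/-- The differential Ore extension `A_h = k[x][t; h ∂_x]`, i.e. the `k`-algebra generated by
`x` and `t` subject to `t x = x t + h(x)`. -/
abbrev A {k : Type*} [Field k] (h : k[X]) : Type _ := RingQuot (Rel h)

variable {k : Type*} [Field k]

/-- The generator `x` of `A_h`. -/
def x (h : k[X]) : A h := RingQuot.mkAlgHom k (Rel h) (FreeAlgebra.ι k 0)

/-- The generator `t` of `A_h`. -/
def t (h : k[X]) : A h := RingQuot.mkAlgHom k (Rel h) (FreeAlgebra.ι k 1)

/-- The element `p(x)` of `A_h` given by a polynomial `p`. -/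
def poly (h p : k[X]) : A h := aeval (x h) p

theorem t_mul_x (h : k[X]) : t h * x h = x h * t h + poly h h := by
  have := RingQuot.mkAlgHom_rel k (Rel.comm (h := h))
  rw [map_mul, map_add, map_mul, ← aeval_algHom_apply] at this
  exact this

theorem poly_mul_x (h p : k[X]) : poly h p * x h = x h * poly h p := by
  have h1 : poly h (p * X) = poly h p * x h := by simp [poly]
  have h2 : poly h (X * p) = x h * poly h p := by simp [poly]
  rw [← h1, ← h2, mul_comm]

/-- The universal property of `A_h`. -/
def lift (h : k[X]) {B : Type*} [Ring B] [Algebra k B] (u v : B)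
    (huv : v * u = u * v + aeval u h) : A h →ₐ[k] B :=
  RingQuot.liftAlgHom k ⟨FreeAlgebra.lift k ![u, v], by
    rintro _ _ ⟨⟩
    rw [map_mul, map_add, map_mul, ← aeval_algHom_apply]
    simpa using huv⟩

section lift

variable (h : k[X]) {B : Type*} [Ring B] [Algebra k B] (u v : B)
  (huv : v * u = u * v + aeval u h)

@[simp] theorem lift_x : lift h u v huv (x h) = u := by simp [lift, x]

@[simp] theorem lift_t : lift h u v huv (t h) = v := by simp [lift, t]

@[simp] theorem lift_poly (p : k[X]) : lift h u v huv (poly h p) = aeval u p := by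
  rw [poly, ← aeval_algHom_apply, lift_x]

theorem hom_ext {h : k[X]} {B : Type*} [Ring B] [Algebra k B] {f g : A h →ₐ[k] B}
    (hx : f (x h) = g (x h)) (ht : f (t h) = g (t h)) : f = g := by
  apply RingQuot.ringQuot_ext'
  apply FreeAlgebra.hom_ext
  funext i
  fin_cases i
  · exact hx
  · exact ht

end lift

/-- The algebra map `A_h → A_h[ε]`, `x ↦ x`, `t ↦ t + s(x) ε`, whose `ε`-part is `Δ_s`. -/
def deltaHom (h s : k[X]) : A h →ₐ[k] TrivSqZeroExt (A h) (A h) :=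
  lift h (TrivSqZeroExt.inl (x h)) (TrivSqZeroExt.inl (t h) + TrivSqZeroExt.inr (poly h s)) (by
    have e : aeval (TrivSqZeroExt.inl (x h) : TrivSqZeroExt (A h) (A h)) h
        = TrivSqZeroExt.inl (poly h h) :=
      aeval_algHom_apply (TrivSqZeroExt.inlAlgHom k (A h) (A h)) (x h) h
    rw [e]
    ext
    · simpa using t_mul_x h
    · simpa using poly_mul_x h s)

theorem fst_deltaHom (h s : k[X]) (a : A h) : (deltaHom h s a).fst = a := by
  have : (TrivSqZeroExt.fstHom k (A h) (A h)).comp (deltaHom h s) = AlgHom.id k (A h) := by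
    apply hom_ext <;> simp [deltaHom]
  exact DFunLike.congr_fun this a

/-- The derivation `Δ_s` of `A_h` with `Δ_s(x) = 0` and `Δ_s(t) = s(x)`. -/
def delta (h s : k[X]) : AlgDer k (A h) where
  toLinearMap := (TrivSqZeroExt.sndHom (A h) (A h)).restrictScalars k ∘ₗ (deltaHom h s).toLinearMap
  leibniz' := by
    intro a b
    simp [fst_deltaHom, add_comm]

theorem delta_x (h s : k[X]) : delta h s (x h) = 0 := by
  change (deltaHom h s (x h)).snd = 0
  simp [deltaHom]

theorem delta_t (h s : k[X]) : delta h s (t h) = poly h s := by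
  change (deltaHom h s (t h)).snd = poly h s
  simp [deltaHom]

/-- The endomorphism `x ↦ x`, `t ↦ t + r(x)` of `A_h`. -/
def sigmaHom (h r : k[X]) : A h →ₐ[k] A h :=
  lift h (x h) (t h + poly h r) (by
    rw [add_mul, mul_add, t_mul_x, poly_mul_x, poly]
    abel)

theorem sigmaHom_comp (h r s : k[X]) :
    (sigmaHom h r).comp (sigmaHom h s) = sigmaHom h (r + s) := by
  apply hom_ext
  · simp [sigmaHom]
  · simp [sigmaHom]
    simp [poly, add_assoc]

theorem sigmaHom_zero (h : k[X]) : sigmaHom h 0 = AlgHom.id k (A h) := by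
  apply hom_ext <;> simp [sigmaHom, poly]

/-- The automorphisms `σ_r` of `A_h`, `σ_r(x) = x` and `σ_r(t) = t + r(x)`, as a homomorphism from
the additive group `k[x]` to `Aut(A_h)`. -/
def sigma (h : k[X]) : Multiplicative k[X] →* (A h ≃ₐ[k] A h) where
  toFun r := AlgEquiv.ofAlgHom (sigmaHom h r.toAdd) (sigmaHom h (-r.toAdd))
    (by rw [sigmaHom_comp, add_neg_cancel, sigmaHom_zero])
    (by rw [sigmaHom_comp, neg_add_cancel, sigmaHom_zero])
  map_one' := by
    ext a
    exact DFunLike.congr_fun (sigmaHom_zero h) a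
  map_mul' r s := by
    ext a
    exact DFunLike.congr_fun (sigmaHom_comp h r.toAdd s.toAdd).symm a

/-- For `h = x`, the endomorphism `x ↦ a x`, `t ↦ t` of `A_x`. -/
def tauHom (a : k) : A (X : k[X]) →ₐ[k] A (X : k[X]) :=
  lift X (a • x X) (t X) (by
    rw [mul_smul_comm, t_mul_x]
    simp [poly, smul_add])

theorem tauHom_comp (a b : k) : (tauHom a).comp (tauHom b) = tauHom (a * b) := by
  apply hom_ext
  · simp [tauHom, smul_smul, mul_comm]
  · simp [tauHom]

theorem tauHom_one : tauHom (1 : k) = AlgHom.id k (A (X : k[X])) := by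
  apply hom_ext <;> simp [tauHom]

/-- For `h = x`, the automorphisms `τ_a` of `A_x`, `τ_a(x) = a x` and `τ_a(t) = t`, as a
homomorphism from `kˣ` to `Aut(A_x)`. -/
def tau : kˣ →* (A (X : k[X]) ≃ₐ[k] A (X : k[X])) where
  toFun a := AlgEquiv.ofAlgHom (tauHom (a : k)) (tauHom ((a⁻¹ : kˣ) : k))
    (by rw [tauHom_comp, Units.mul_inv, tauHom_one])
    (by rw [tauHom_comp, Units.inv_mul, tauHom_one])
  map_one' := by
    ext a
    exact DFunLike.congr_fun tauHom_one a
  map_mul' a b := by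
    ext c
    exact DFunLike.congr_fun (tauHom_comp (a : k) (b : k)).symm c

/-- The additive automorphism `r(x) ↦ r(a x)` of `k[x]`, for `a` in `kˣ`. -/
def scale : kˣ →* MulAut (Multiplicative k[X]) where
  toFun a :=
    { toFun := fun r => .ofAdd (r.toAdd.comp (C (a : k) * X))
      invFun := fun r => .ofAdd (r.toAdd.comp (C ((a⁻¹ : kˣ) : k) * X))
      left_inv := fun r => by simp [comp_assoc, ← mul_assoc, ← C_mul, -map_mul]
      right_inv := fun r => by simp [comp_assoc, ← mul_assoc, ← C_mul, -map_mul]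
      map_mul' := fun r s => by simp }
  map_one' := by
    ext r : 1
    simp
  map_mul' a b := by
    ext r : 1
    apply Multiplicative.toAdd.injective
    change r.toAdd.comp (C ((a * b : kˣ) : k) * X)
      = (r.toAdd.comp (C (b : k) * X)).comp (C (a : k) * X)
    rw [comp_assoc, mul_comp, C_comp, X_comp, ← mul_assoc, ← C_mul, Units.val_mul, mul_comm (a : k)]

theorem tau_sigma (a : kˣ) (r : Multiplicative k[X]) :
    sigma X (scale a r) = tau a * sigma X r * (tau a)⁻¹ := by
  rw [eq_mul_inv_iff_mul_eq]
  apply AlgEquiv.coe_toAlgHom_injective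
  apply hom_ext
  · change sigmaHom X _ (tauHom _ _) = tauHom _ (sigmaHom X _ _)
    simp [sigmaHom, tauHom]
  · change sigmaHom X _ (tauHom _ _) = tauHom _ (sigmaHom X _ _)
    simp only [sigmaHom, tauHom, lift_t, map_add, lift_poly]
    simp [poly, scale, aeval_comp, Algebra.smul_def]

/-- The semidirect product `k[x] ⋊ 𝔾_n`, where the group `𝔾_n` of `n`-th roots of unity acts on the
additive group `k[x]` by `a · r(x) = r(a x)`. -/
abbrev PolySemidirect (k : Type*) [Field k] (n : ℕ) : Type _ :=
  Multiplicative k[X] ⋊[scale.comp (rootsOfUnity n k).subtype] (rootsOfUnity n k)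

/-- The group homomorphism from `k[x] ⋊ 𝔾_n` to `Aut(A_x)` sending `(r, a)` to `σ_r ∘ τ_a`; its image is
the copy of `k[x] ⋊ 𝔾_n` inside `Aut(A_x)`. -/
def semidirectToAut (k : Type*) [Field k] (n : ℕ) :
    PolySemidirect k n →* (A (X : k[X]) ≃ₐ[k] A (X : k[X])) :=
  SemidirectProduct.lift (sigma X) (tau.comp (rootsOfUnity n k).subtype) (by
    intro a
    apply MonoidHom.ext
    intro r
    exact tau_sigma (a : kˣ) r)

theorem semidirectToAut_apply (n : ℕ) (g : PolySemidirect k n) :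
    semidirectToAut k n g = sigma X g.left * tau (g.right : kˣ) := rfl

end DiffOre

end

/-!
# Isotropy groups of derivations of `A_x`

Every automorphism of `A_x` is `σ_r τ_a` (`exists_eq_sigma_mul_tau`): since `x = [t, x]`, an
automorphism and its inverse both send `x` into `x A_x`, and `A_x` is a domain whose units are
scalars, so `x` goes to `a x`; then the image of `t` differs from `t` by an element of the
centralizer of `x`, which is `k[x]` in characteristic zero.

If `σ_r τ_a` commutes with `D = ad_w + Δ_s`, where `s` is a constant, compare the coefficients of
`t ^ l` in `σ_r τ_a (D t) = D (t + r(x))`. Because `[p(x) tⁱ, t] = -x p'(x) tⁱ`, and `[w, r(x)]` has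
no term in `t ^ l`, this gives `u(a x) = u(x)` for `u = x w_l'` (`comp_eq_of_mem_isotropy`). In
characteristic zero `u` has the same degree `n ≥ 1` as `w_l`, so the leading coefficients give
`a ^ n = 1`, with `n` depending only on `w`.

The computations use that the elements `xⁱ tʲ` form a basis of `A_x`. This is read off from the left
regular representation on `k[x][T]`, where `t` acts by `T + x ∂ₓ` (`regRep`, `nf`); the resulting
degree in `t` has multiplicative leading coefficients (`HasSymbol.mul`).
-/

noncomputable section

namespace DiffOre

variable {k : Type*} [Field k]

/-! ### Normal forms -/

/-- The derivation `∑ pᵢ(x) Tⁱ ↦ ∑ x pᵢ'(x) Tⁱ` of `k[x][T]`: the derivation `x ∂ₓ` applied to the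
coefficients. -/
def eulerDer (k : Type*) [Field k] : Derivation k k[X][X] k[X][X] :=
  (PolynomialModule.equivPolynomialSelf (R := k[X])).toLinearMap.compDer
    (((X : k[X]) • derivative' : Derivation k k[X] k[X]).mapCoeffs)

theorem coeff_eulerDer (q : k[X][X]) (n : ℕ) :
    (eulerDer k q).coeff n = X * derivative (q.coeff n) := rfl

theorem eulerDer_C (p : k[X]) : eulerDer k (C p) = C (X * derivative p) := by
  ext1 n
  rw [coeff_eulerDer, coeff_C, coeff_C]
  split_ifs <;> simp

theorem eulerDer_X : eulerDer k (X : k[X][X]) = 0 := by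
  ext1 n
  rw [coeff_eulerDer, coeff_X]
  split_ifs <;> simp

theorem eulerDer_taylor (q : k[X][X]) :
    eulerDer k (taylor 1 q) = taylor 1 (eulerDer k q) := by
  induction q using Polynomial.induction_on' with
  | add p q hp hq => simp only [map_add, hp, hq]
  | monomial n p =>
    rw [← C_mul_X_pow_eq_monomial]
    induction n with
    | zero => simp [eulerDer_C]
    | succ n ih =>
      have h1 : eulerDer k ((X : k[X][X]) + C 1) = 0 := by
        simp [eulerDer_X]
      rw [pow_succ, ← mul_assoc, taylor_mul, taylor_X, Derivation.leibniz, Derivation.leibniz,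
        eulerDer_X, h1, ih]
      rw [smul_zero, smul_zero, zero_add, zero_add, smul_eq_mul, smul_eq_mul, taylor_mul, taylor_X,
        mul_comm]

/-- The left regular representation of `A_x` in normal form: `k[x][T]` stands for the sums
`∑ pᵢ(x) tⁱ`, on which `x` acts by multiplication and `t` by `T + x ∂ₓ`. -/
def regRep (k : Type*) [Field k] : A (X : k[X]) →ₐ[k] Module.End k k[X][X] :=
  lift X (B := Module.End k k[X][X]) (LinearMap.mulLeft k (C X))
    (LinearMap.mulLeft k X + (eulerDer k).toLinearMap) (by
    ext1 q
    simp [eulerDer_C]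
    ring)

theorem regRep_x (q : k[X][X]) : regRep k (x X) q = C X * q := by
  simp [regRep]

theorem regRep_t (q : k[X][X]) : regRep k (t X) q = X * q + eulerDer k q := by
  simp [regRep]

theorem regRep_poly (p : k[X]) (q : k[X][X]) : regRep k (poly X p) q = C p * q := by
  rw [poly, ← aeval_algHom_apply]
  induction p using Polynomial.induction_on generalizing q with
  | C a => simp [Algebra.smul_def, Polynomial.algebraMap_apply]
  | add p r hp hr => simp [hp, hr, add_mul]
  | monomial n a ih =>
    rw [pow_succ, ← mul_assoc, map_mul, aeval_X, Module.End.mul_apply, regRep_x, ih]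
    simp only [map_mul]
    ring

/-- The normal form of an element of `A_x`: the polynomial `∑ pᵢ(x) Tⁱ` for `∑ pᵢ(x) tⁱ`. -/
def nf (k : Type*) [Field k] : A (X : k[X]) →ₗ[k] k[X][X] :=
  LinearMap.applyₗ 1 ∘ₗ (regRep k).toLinearMap

theorem nf_mul (b c : A (X : k[X])) : nf k (b * c) = regRep k b (nf k c) := by
  simp [nf]

theorem nf_one : nf k 1 = 1 := by simp [nf]

theorem nf_poly_mul (p : k[X]) (b : A (X : k[X])) : nf k (poly X p * b) = C p * nf k b := by
  rw [nf_mul, regRep_poly]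

theorem nf_poly (p : k[X]) : nf k (poly X p) = C p := by
  simpa [nf_one] using nf_poly_mul p 1

theorem nf_x_mul (b : A (X : k[X])) : nf k (x X * b) = C X * nf k b := by
  rw [nf_mul, regRep_x]

theorem nf_t_mul (b : A (X : k[X])) : nf k (t X * b) = X * nf k b + eulerDer k (nf k b) := by
  rw [nf_mul, regRep_t]

theorem induction {P : A (X : k[X]) → Prop} (hx : P (x X)) (ht : P (t X))
    (hC : ∀ c : k, P (algebraMap k _ c)) (hadd : ∀ b c, P b → P c → P (b + c))
    (hmul : ∀ b c, P b → P c → P (b * c)) (b : A (X : k[X])) : P b := by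
  let S : Subalgebra k (A (X : k[X])) :=
    { carrier := {b | P b}
      mul_mem' := fun {b c} => hmul b c
      add_mem' := fun {b c} => hadd b c
      algebraMap_mem' := hC }
  let x' : S := ⟨x X, hx⟩
  let t' : S := ⟨t X, ht⟩
  have hrel : t' * x' = x' * t' + aeval x' (X : k[X]) := by
    apply Subtype.ext
    simpa [poly] using t_mul_x (X : k[X])
  have hf : S.val.comp (lift X x' t' hrel) = AlgHom.id k _ := by
    apply hom_ext <;> simp [x', t']
  have hb := DFunLike.congr_fun hf b
  rw [AlgHom.id_apply] at hb
  rw [← hb]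
  exact (lift X x' t' hrel b).2

/-- An operator commuting with left multiplication by `x` and by `t` commutes with all of `A_x`. -/
theorem regRep_comm {R : Module.End k k[X][X]}
    (hx : ∀ q, regRep k (x X) (R q) = R (regRep k (x X) q))
    (ht : ∀ q, regRep k (t X) (R q) = R (regRep k (t X) q)) (b : A (X : k[X])) (q : k[X][X]) :
    regRep k b (R q) = R (regRep k b q) := by
  induction b using induction generalizing q with
  | hx => exact hx q
  | ht => exact ht q
  | hC c => simp
  | hadd b c hb hc => simp [hb, hc]
  | hmul b c hb hc => simp [hb, hc]

theorem nf_mul_t (b : A (X : k[X])) : nf k (b * t X) = nf k b * X := by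
  have h := regRep_comm (R := LinearMap.mulRight k (X : k[X][X]))
    (fun q => by simp [regRep_x, mul_assoc])
    (fun q => by simp [regRep_t, eulerDer_X]; ring) b 1
  rw [nf_mul, ← mul_one (t X), nf_t_mul, nf_one]
  simpa [nf] using h

theorem nf_mul_t_pow (b : A (X : k[X])) (n : ℕ) : nf k (b * t X ^ n) = nf k b * X ^ n := by
  induction n with
  | zero => simp
  | succ n ih => rw [pow_succ, ← mul_assoc, nf_mul_t, ih, mul_assoc, pow_succ]

/-- Moving `x` to the left past `f(t)` replaces it by `f(t + 1)`. -/
theorem nf_mul_x (b : A (X : k[X])) : nf k (b * x X) = C X * taylor 1 (nf k b) := by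
  have h := regRep_comm
    (R := LinearMap.mulLeft k (C X) ∘ₗ (taylor (1 : k[X])).restrictScalars k)
    (fun q => by simp [regRep_x, taylor_mul])
    (fun q => by
      simp [regRep_t, taylor_mul, eulerDer_taylor, eulerDer_C]
      ring) b 1
  rw [nf_mul, ← mul_one (x X), nf_x_mul, nf_one]
  simpa [nf] using h

theorem nf_sum (w : ℕ → k[X]) (s : Finset ℕ) :
    nf k (∑ i ∈ s, poly X (w i) * t X ^ i) = ∑ i ∈ s, C (w i) * X ^ i := by
  simp only [map_sum, nf_mul_t_pow, nf_poly]

theorem nf_surjective : Function.Surjective (nf k) := fun q =>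
  ⟨∑ i ∈ q.support, poly X (q.coeff i) * t X ^ i, by rw [nf_sum, ← q.as_sum_support_C_mul_X_pow]⟩

theorem t_mul_poly (p : k[X]) :
    t X * poly X p = poly X p * t X + poly X (X * derivative p) := by
  induction p using Polynomial.induction_on with
  | C a => simp [poly, Algebra.commutes]
  | add p r hp hr =>
    simp only [poly, map_add, mul_add, add_mul] at hp hr ⊢
    rw [hp, hr]
    abel
  | monomial n a ih =>
    have h (p : k[X]) : poly X (p * X) = poly X p * x X := by simp [poly]
    have h' (p : k[X]) : poly X p * poly X X = poly X (p * X) := by simp [poly]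
    rw [pow_succ, ← mul_assoc, h, ← mul_assoc, ih, add_mul, mul_assoc, t_mul_x, mul_add,
      ← mul_assoc, ← h, h', ← h, add_assoc]
    congr 1
    rw [poly, poly, poly, ← map_add]
    congr 1
    rw [derivative_mul (f := C a * X ^ n), derivative_X]
    ring

/-- The element `∑ pᵢ(x) tⁱ` of `A_x` with normal form `∑ pᵢ(x) Tⁱ`. -/
def ofNf (k : Type*) [Field k] : k[X][X] →ₗ[k] A (X : k[X]) where
  toFun q := q.sum fun i p => poly X p * t X ^ i
  map_add' p q := sum_add_index _ _ _ (by simp [poly]) (by simp [poly, add_mul])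
  map_smul' c q := by
    rw [sum_smul_index' _ _ _ (by simp [poly]), RingHom.id_apply, sum_def, sum_def,
      Finset.smul_sum]
    simp [poly]

theorem ofNf_monomial (n : ℕ) (p : k[X]) : ofNf k (monomial n p) = poly X p * t X ^ n :=
  sum_monomial_index p (fun i p => poly X p * t X ^ i) (by simp [poly])

/-- The span of the `xⁱ tʲ` is stable under left multiplication by `t`, by `t_mul_poly`; hence
`ofNf` intertwines `regRep` with the left regular action, and `ofNf ∘ nf` is the identity. -/
theorem ofNf_regRep (b : A (X : k[X])) (q : k[X][X]) :
    ofNf k (regRep k b q) = b * ofNf k q := by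
  induction b using induction generalizing q with
  | hx =>
    rw [regRep_x]
    induction q using Polynomial.induction_on' with
    | add p q hp hq => simp only [mul_add, map_add, hp, hq]
    | monomial n p => rw [C_mul_monomial, ofNf_monomial, ofNf_monomial]; simp [poly, mul_assoc]
  | ht =>
    rw [regRep_t]
    induction q using Polynomial.induction_on' with
    | add p q hp hq =>
      simp only [mul_add, map_add] at hp hq ⊢
      rw [← hp, ← hq]
      abel
    | monomial n p =>
      have h : eulerDer k (monomial n p) = monomial n (X * derivative p) := by
        ext1 m
        rw [coeff_eulerDer, coeff_monomial, coeff_monomial]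
        split_ifs <;> simp
      rw [h, X_mul_monomial, map_add, ofNf_monomial, ofNf_monomial, ofNf_monomial, ← mul_assoc,
        t_mul_poly, add_mul, pow_succ', mul_assoc]
  | hC c => rw [AlgHom.commutes, Module.algebraMap_end_apply, map_smul, Algebra.smul_def]
  | hadd b c hb hc => simp [hb, hc, add_mul]
  | hmul b c hb hc => simp [hb, hc, mul_assoc]

theorem ofNf_nf (b : A (X : k[X])) : ofNf k (nf k b) = b := by
  have h : ofNf k 1 = 1 := by
    rw [← monomial_zero_one, ofNf_monomial]
    simp [poly]
  have hb := ofNf_regRep b 1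
  rwa [h, mul_one] at hb

theorem nf_injective : Function.Injective (nf k) := Function.LeftInverse.injective ofNf_nf

/-! ### Leading terms with respect to `t` -/

/-- `HasSymbol b n p`: the element `b` is `p(x) tⁿ` up to terms of lower degree in `t`. The symbol
`p` may vanish, in which case `b` has degree less than `n` in `t` (or `n = 0` and `b = 0`). -/
def HasSymbol (b : A (X : k[X])) (n : ℕ) (p : k[X]) : Prop :=
  (nf k b).natDegree ≤ n ∧ (nf k b).coeff n = p

namespace HasSymbol

variable {b c : A (X : k[X])} {m n : ℕ} {p q : k[X]}

theorem unique (hb : HasSymbol b n p) (hc : HasSymbol b n q) : p = q :=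
  hb.2.symm.trans hc.2

theorem add (hb : HasSymbol b n p) (hc : HasSymbol c n q) : HasSymbol (b + c) n (p + q) := by
  refine ⟨?_, by rw [map_add, coeff_add, hb.2, hc.2]⟩
  rw [map_add]
  exact (natDegree_add_le _ _).trans (max_le hb.1 hc.1)

theorem sub (hb : HasSymbol b n p) (hc : HasSymbol c n q) : HasSymbol (b - c) n (p - q) := by
  refine ⟨?_, by rw [map_sub, coeff_sub, hb.2, hc.2]⟩
  rw [map_sub]
  exact (natDegree_sub_le _ _).trans (max_le hb.1 hc.1)

theorem zero (n : ℕ) : HasSymbol (0 : A (X : k[X])) n 0 := by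
  simp [HasSymbol]

theorem of_lt (hb : HasSymbol b m p) (h : m < n) : HasSymbol b n 0 :=
  ⟨hb.1.trans h.le, coeff_eq_zero_of_natDegree_lt (hb.1.trans_lt h)⟩

theorem sum {ι : Type*} {s : Finset ι} {b : ι → A (X : k[X])} {p : ι → k[X]}
    (h : ∀ i ∈ s, HasSymbol (b i) n (p i)) :
    HasSymbol (∑ i ∈ s, b i) n (∑ i ∈ s, p i) := by
  classical
  induction s using Finset.induction_on with
  | empty => simpa using zero n
  | insert a s ha ih =>
    rw [Finset.sum_insert ha, Finset.sum_insert ha]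
    exact (h a (Finset.mem_insert_self a s)).add
      (ih fun i hi => h i (Finset.mem_insert_of_mem hi))

theorem poly (p : k[X]) : HasSymbol (poly X p) 0 p := by
  simp [HasSymbol, nf_poly]

theorem smul (a : k) (hb : HasSymbol b n p) : HasSymbol (a • b) n (a • p) := by
  refine ⟨?_, by rw [map_smul, coeff_smul, hb.2]⟩
  rw [map_smul]
  exact (natDegree_smul_le _ _).trans hb.1

theorem mul_t_pow (hb : HasSymbol b n p) (m : ℕ) : HasSymbol (b * t X ^ m) (n + m) p := by
  refine ⟨?_, by rw [nf_mul_t_pow, coeff_mul_X_pow, hb.2]⟩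
  rw [nf_mul_t_pow]
  exact natDegree_mul_le_of_le hb.1 (natDegree_X_pow_le m)

theorem t : HasSymbol (t (X : k[X])) 1 1 := by
  simpa [DiffOre.poly] using (poly (1 : k[X])).mul_t_pow 1

theorem mul_x (hb : HasSymbol b n p) : HasSymbol (b * x X) n (X * p) := by
  have h : (taylor 1 (nf k b)).natDegree ≤ n := (natDegree_taylor _ _).trans_le hb.1
  refine ⟨?_, ?_⟩
  · rw [nf_mul_x]
    exact (natDegree_C_mul_le _ _).trans h
  · rw [nf_mul_x, coeff_C_mul]
    congr 1
    rcases hb.1.eq_or_lt with hd | hd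
    · rw [← hb.2, ← hd, coeff_taylor_natDegree, leadingCoeff]
    · rw [← hb.2, coeff_eq_zero_of_natDegree_lt hd, coeff_eq_zero_of_natDegree_lt]
      rwa [natDegree_taylor]

theorem mul_poly (hb : HasSymbol b n p) (q : k[X]) :
    HasSymbol (b * DiffOre.poly X q) n (p * q) := by
  induction q using Polynomial.induction_on with
  | C a =>
    have : b * DiffOre.poly X (C a) = a • b := by
      rw [DiffOre.poly, aeval_C, ← Algebra.commutes, Algebra.smul_def]
    rw [this, mul_comm, ← smul_eq_C_mul]
    exact hb.smul a
  | add q r hq hr =>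
    have : b * DiffOre.poly X (q + r) = b * DiffOre.poly X q + b * DiffOre.poly X r := by
      simp [DiffOre.poly, mul_add]
    rw [this, mul_add]
    exact hq.add hr
  | monomial m a ih =>
    have : b * DiffOre.poly X (C a * X ^ (m + 1)) = b * DiffOre.poly X (C a * X ^ m) * x X := by
      simp [DiffOre.poly, pow_succ, mul_assoc]
    rw [this, show p * (C a * X ^ (m + 1)) = X * (p * (C a * X ^ m)) by ring]
    exact ih.mul_x

/-- Every element is the sum of the terms of its normal form up to any bound for its degree. -/
theorem eq_sum (hb : HasSymbol b n p) :
    b = ∑ i ∈ Finset.range (n + 1), DiffOre.poly X ((nf k b).coeff i) * DiffOre.t X ^ i := by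
  apply nf_injective
  rw [nf_sum, ← as_sum_range_C_mul_X_pow' _ (Nat.lt_succ_of_le hb.1)]

/-- The associated graded algebra of the filtration by degree in `t` is commutative: symbols
multiply. -/
theorem mul (hb : HasSymbol b m p) (hc : HasSymbol c n q) : HasSymbol (b * c) (m + n) (p * q) := by
  rw [hc.eq_sum, Finset.sum_range_succ, mul_add, hc.2, ← zero_add (p * q)]
  refine add ?_ ?_
  · rw [Finset.mul_sum, ← Finset.sum_const_zero (s := Finset.range n)]
    refine sum fun i hi => ?_
    rw [← mul_assoc]
    exact ((hb.mul_poly _).mul_t_pow i).of_lt (by simpa using hi)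
  · rw [← mul_assoc]
    exact (hb.mul_poly q).mul_t_pow n

theorem pow_t_add (r : k[X]) (n : ℕ) : HasSymbol ((DiffOre.t X + DiffOre.poly X r) ^ n) n 1 := by
  induction n with
  | zero => simpa [DiffOre.poly] using poly (1 : k[X])
  | succ n ih => simpa [pow_succ] using ih.mul (t.add ((poly r).of_lt one_pos))

end HasSymbol

theorem hasSymbol_natDegree (b : A (X : k[X])) :
    HasSymbol b (nf k b).natDegree (nf k b).leadingCoeff := ⟨le_rfl, rfl⟩

instance : NoZeroDivisors (A (X : k[X])) where
  eq_zero_or_eq_zero_of_mul_eq_zero {b c} h := by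
    have := ((hasSymbol_natDegree b).mul (hasSymbol_natDegree c)).2
    rw [h, map_zero, coeff_zero, zero_eq_mul, leadingCoeff_eq_zero, leadingCoeff_eq_zero] at this
    exact this.imp (fun h => nf_injective (by rw [h, map_zero]))
      fun h => nf_injective (by rw [h, map_zero])

theorem exists_eq_algebraMap_of_mul_eq_one {b c : A (X : k[X])} (h : b * c = 1) :
    ∃ a : k, b = algebraMap k _ a := by
  have hbc := ((hasSymbol_natDegree b).mul (hasSymbol_natDegree c)).2
  have hb : nf k b ≠ 0 := by
    intro h0
    have h1 : nf k (b * c) = 0 := by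
      rw [nf_injective (h0.trans (map_zero _).symm), zero_mul, map_zero]
    rw [h, nf_one] at h1
    exact one_ne_zero h1
  have hc : nf k c ≠ 0 := by
    intro h0
    have h1 : nf k (b * c) = 0 := by
      rw [nf_injective (h0.trans (map_zero _).symm), mul_zero, map_zero]
    rw [h, nf_one] at h1
    exact one_ne_zero h1
  have hne : (nf k b).leadingCoeff * (nf k c).leadingCoeff ≠ 0 :=
    mul_ne_zero (leadingCoeff_ne_zero.2 hb) (leadingCoeff_ne_zero.2 hc)
  rw [h, nf_one, coeff_one] at hbc
  split_ifs at hbc with hd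
  · obtain ⟨a, -, ha⟩ := isUnit_iff.1 (IsUnit.of_mul_eq_one _ hbc.symm)
    refine ⟨a, nf_injective ?_⟩
    have hpa : algebraMap k (A (X : k[X])) a = poly X (C a) := by simp [poly]
    rw [eq_C_of_natDegree_eq_zero (show (nf k b).natDegree = 0 by omega), hpa, nf_poly, ha,
      leadingCoeff]
    rw [show (nf k b).natDegree = 0 by omega]
  · exact absurd hbc.symm hne

/-! ### Automorphisms of `A_x` -/

/-- The quotient map `A_x → A_x / (x) = k[t]`. -/
def modX (k : Type*) [Field k] : A (X : k[X]) →ₐ[k] k[X] :=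
  lift X 0 X (by simp)

theorem modX_eq (b : A (X : k[X])) : modX k b = (nf k b).map (evalRingHom 0) := by
  rw [(hasSymbol_natDegree b).eq_sum, nf_sum]
  have h (p : k[X]) : aeval (0 : k[X]) p = C (p.eval 0) := by
    rw [← map_zero (algebraMap k k[X]), aeval_algebraMap_apply, algebraMap_eq, coe_aeval_eq_eval]
  simp [modX, Polynomial.map_sum, h]

theorem exists_eq_x_mul_of_modX_eq_zero {b : A (X : k[X])} (h : modX k b = 0) :
    ∃ c, b = x X * c := by
  have hd : C (X : k[X]) ∣ nf k b := by
    rw [C_dvd_iff_dvd_coeff]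
    intro i
    rw [X_dvd_iff, coeff_zero_eq_eval_zero, ← coe_evalRingHom, ← coeff_map, ← modX_eq, h,
      coeff_zero]
  obtain ⟨q, hq⟩ := hd
  obtain ⟨c, rfl⟩ := nf_surjective q
  exact ⟨c, nf_injective (by rw [hq, nf_x_mul])⟩

/-- The image of `x` under an endomorphism lies in the commutator ideal `x A_x`, because
`x = [t, x]` is killed by every homomorphism to a commutative algebra. -/
theorem exists_map_x_eq (f : A (X : k[X]) →ₐ[k] A (X : k[X])) : ∃ c, f (x X) = x X * c := by
  apply exists_eq_x_mul_of_modX_eq_zero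
  have h := congrArg (fun b => modX k (f b)) (t_mul_x (X : k[X]))
  simp only [map_mul, map_add, poly, aeval_X] at h
  rw [mul_comm] at h
  exact left_eq_add.1 h

theorem x_ne_zero : x (X : k[X]) ≠ 0 := by
  intro h
  have := nf_x_mul (1 : A (X : k[X]))
  rw [h, zero_mul, map_zero, nf_one, mul_one, eq_comm, C_eq_zero] at this
  exact X_ne_zero this

theorem exists_map_x_eq_smul (ρ : A (X : k[X]) ≃ₐ[k] A (X : k[X])) :
    ∃ a : kˣ, ρ (x X) = (a : k) • x X := by
  obtain ⟨b, hb⟩ := exists_map_x_eq (ρ : A (X : k[X]) →ₐ[k] A (X : k[X]))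
  obtain ⟨c, hc⟩ := exists_map_x_eq (ρ.symm : A (X : k[X]) →ₐ[k] A (X : k[X]))
  change ρ (x X) = _ at hb
  change ρ.symm (x X) = _ at hc
  have h1 : b * ρ c = 1 := by
    apply mul_left_cancel₀ (x_ne_zero (k := k))
    rw [← mul_assoc, ← hb, ← map_mul, ← hc, ρ.apply_symm_apply, mul_one]
  obtain ⟨a, rfl⟩ := exists_eq_algebraMap_of_mul_eq_one h1
  have ha : a ≠ 0 := by
    rintro rfl
    rw [map_zero, mul_zero] at hb
    exact x_ne_zero (ρ.injective (hb.trans (map_zero ρ).symm))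
  exact ⟨Units.mk0 a ha, by rw [hb, ← Algebra.commutes, Algebra.smul_def, Units.val_mk0]⟩

theorem natDegree_eq_zero_of_taylor_eq_self {R : Type*} [CommRing R] [IsDomain R] [CharZero R]
    {q : R[X]} (h : taylor 1 q = q) : q.natDegree = 0 := by
  have hn (n : ℕ) : q.eval (n : R) = q.eval 0 := by
    induction n with
    | zero => simp
    | succ n ih => rw [← ih, Nat.cast_succ, ← taylor_eval, h]
  have : q = C (q.eval 0) := by
    apply Polynomial.eq_of_infinite_eval_eq
    refine Set.Infinite.mono ?_ (Set.infinite_range_of_injective (Nat.cast_injective (R := R)))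
    rintro _ ⟨n, rfl⟩
    simp [hn n]
  rw [this, natDegree_C]

/-- In characteristic zero the centralizer of `x` is `k[x]`. -/
theorem exists_eq_poly_of_commute_x [CharZero k] {b : A (X : k[X])} (h : b * x X = x X * b) :
    ∃ p, b = poly X p := by
  have ht : taylor 1 (nf k b) = nf k b := by
    apply mul_left_cancel₀ (C_ne_zero.2 (X_ne_zero (R := k)))
    rw [← nf_mul_x, ← nf_x_mul, h]
  refine ⟨(nf k b).coeff 0, nf_injective ?_⟩
  rw [nf_poly, ← eq_C_of_natDegree_eq_zero (natDegree_eq_zero_of_taylor_eq_self ht)]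

theorem exists_eq_sigma_mul_tau [CharZero k] (ρ : A (X : k[X]) ≃ₐ[k] A (X : k[X])) :
    ∃ (r : k[X]) (a : kˣ), ρ = sigma X (.ofAdd r) * tau a := by
  obtain ⟨a, ha⟩ := exists_map_x_eq_smul ρ
  have hx : poly (X : k[X]) X = x X := by simp [poly]
  have hcomm : (ρ (t X) - t X) * x X = x X * (ρ (t X) - t X) := by
    have h := congrArg ρ (t_mul_x (X : k[X]))
    rw [hx, map_add, map_mul, map_mul, ha, mul_smul_comm, smul_mul_assoc, ← smul_add] at h
    have h' := smul_right_injective _ a.ne_zero h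
    rw [sub_mul, mul_sub, h', t_mul_x, hx]
    abel
  obtain ⟨r, hr⟩ := exists_eq_poly_of_commute_x hcomm
  refine ⟨r, a, ?_⟩
  apply AlgEquiv.coe_toAlgHom_injective
  apply hom_ext
  · change ρ (x X) = sigmaHom X r (tauHom (a : k) (x X))
    simp [sigmaHom, tauHom, ha]
  · change ρ (t X) = sigmaHom X r (tauHom (a : k) (t X))
    simp [sigmaHom, tauHom, ← hr]

/-! ### The isotropy group -/

theorem sigma_tau_t (r : k[X]) (a : kˣ) :
    (sigma (X : k[X]) (.ofAdd r) * tau a) (t (X : k[X])) = t X + poly X r := by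
  change sigmaHom X r (tauHom (a : k) (t X)) = _
  simp [sigmaHom, tauHom]

theorem sigma_tau_poly (r : k[X]) (a : kˣ) (p : k[X]) :
    (sigma (X : k[X]) (.ofAdd r) * tau a) (poly X p) =
      poly X (p.comp (C (a : k) * X)) := by
  change sigmaHom X r (tauHom (a : k) (poly X p)) = _
  simp [sigmaHom, tauHom, poly, ← aeval_algHom_apply, aeval_comp, Algebra.smul_def]

theorem HasSymbol.sigma_tau {b : A (X : k[X])} {n : ℕ} {p : k[X]} (hb : HasSymbol b n p)
    (r : k[X]) (a : kˣ) :
    HasSymbol ((sigma (X : k[X]) (.ofAdd r) * tau a) b) n (p.comp (C (a : k) * X)) := by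
  have h (q : k[X]) (i : ℕ) : HasSymbol ((sigma (X : k[X]) (.ofAdd r) * tau a) (DiffOre.poly X q *
      DiffOre.t X ^ i)) i (q.comp (C (a : k) * X)) := by
    rw [map_mul, map_pow, sigma_tau_t, sigma_tau_poly]
    simpa using (HasSymbol.poly _).mul (HasSymbol.pow_t_add r i)
  rw [hb.eq_sum, Finset.sum_range_succ, hb.2, map_add, map_sum, ← zero_add (p.comp _)]
  refine HasSymbol.add ?_ (h p n)
  rw [← Finset.sum_const_zero (s := Finset.range n)]
  exact HasSymbol.sum fun i hi => (h _ i).of_lt (by simpa using hi)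

theorem delta_poly (s r : k[X]) : delta X s (poly X r) = 0 := by
  have h : deltaHom X s (poly X r) = TrivSqZeroExt.inl (poly X r) := by
    rw [deltaHom, lift_poly]
    exact aeval_algHom_apply (TrivSqZeroExt.inlAlgHom k (A (X : k[X])) (A (X : k[X]))) (x X) r
  change (deltaHom X s (poly X r)).snd = 0
  rw [h, TrivSqZeroExt.snd_inl]

/-- Since `[p(x) tⁱ, t] = -x p'(x) tⁱ`, the symbol of `[b, t]` is `-x p'` where `p` is that
of `b`. -/
theorem HasSymbol.ad_t {b : A (X : k[X])} {n : ℕ} {p : k[X]} (hb : HasSymbol b n p) :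
    HasSymbol (AlgDer.ad k b (DiffOre.t X)) n (-(X * derivative p)) := by
  have h : nf k (AlgDer.ad k b (DiffOre.t X)) = -eulerDer k (nf k b) := by
    change nf k (b * DiffOre.t X - DiffOre.t X * b) = _
    rw [map_sub, nf_mul_t, nf_t_mul]
    ring
  refine ⟨?_, by rw [h, coeff_neg, coeff_eulerDer, hb.2]⟩
  rw [h, natDegree_neg, natDegree_le_iff_coeff_eq_zero]
  intro i hi
  rw [coeff_eulerDer, coeff_eq_zero_of_natDegree_lt (hb.1.trans_lt hi), derivative_zero, mul_zero]

theorem HasSymbol.ad_poly {b : A (X : k[X])} {n : ℕ} {p : k[X]} (hb : HasSymbol b n p)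
    (r : k[X]) : HasSymbol (AlgDer.ad k b (DiffOre.poly X r)) n 0 := by
  have h := (hb.mul_poly r).sub (by simpa using (HasSymbol.poly r).mul hb)
  rwa [mul_comm p, sub_self] at h

/-- An automorphism `σ_r τ_a` commuting with `ad_w + Δ_c` preserves the symbol `-x p'(x)` of
`[w, t]` when `x` is replaced by `a x`; the constant `c` only contributes to the degree `0` in `t`,
and is unaffected. -/
theorem comp_eq_of_mem_isotropy {W : A (X : k[X])} {n : ℕ} {p : k[X]} (hW : HasSymbol W n p)
    {c : k} {r : k[X]} {a : kˣ}
    (h : sigma (X : k[X]) (.ofAdd r) * tau a ∈ (AlgDer.ad k W + delta X (C c)).isotropy) :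
    (X * derivative p).comp (C (a : k) * X) = X * derivative p := by
  have ht := h (t X)
  rw [sigma_tau_t] at ht
  change (sigma (X : k[X]) (.ofAdd r) * tau a) (AlgDer.ad k W (t X) + delta X (C c) (t X)) =
    AlgDer.ad k W (t X + poly X r) + delta X (C c) (t X + poly X r) at ht
  rw [map_add, map_add, map_add, delta_t, delta_poly, sigma_tau_poly, C_comp, add_zero,
    add_left_inj] at ht
  have h1 := hW.ad_t.sigma_tau r a
  have h2 := hW.ad_t.add (hW.ad_poly r)
  rw [← ht] at h2
  simpa using h1.unique h2

theorem pow_natDegree_eq_one [CharZero k] {p : k[X]} (hp : 1 ≤ p.natDegree) {a : k}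
    (h : (X * derivative p).comp (C a * X) = X * derivative p) : a ^ p.natDegree = 1 := by
  have hc : (X * derivative p).coeff p.natDegree ≠ 0 := by
    obtain ⟨d, hd⟩ : ∃ d, p.natDegree = d + 1 := ⟨_, (Nat.sub_add_cancel hp).symm⟩
    rw [hd, coeff_X_mul, coeff_derivative, ← hd]
    refine mul_ne_zero (leadingCoeff_ne_zero.2 ?_) (Nat.cast_add_one_ne_zero d)
    rintro rfl
    simp at hp
  have h' := congrArg (fun q => q.coeff p.natDegree) h
  simp only [comp_C_mul_X_coeff] at h'
  exact mul_left_cancel₀ hc (by rw [h', mul_one])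

end DiffOre

end

theorem mainTheorem10 {k : Type*} [Field k] [IsAlgClosed k] [CharZero k]
    (s : k[X]) (hs : s.degree < (X : k[X]).degree)
    (l : ℕ) (w : ℕ → k[X]) (hw : 1 ≤ (w l).degree)
    (W : DiffOre.A (X : k[X]))
    (hW : W = ∑ i ∈ Finset.range (l + 1), DiffOre.poly X (w i) * DiffOre.t X ^ i) :
    ∃ n : ℕ, 1 ≤ n ∧
      (DiffOre.AlgDer.ad k W + DiffOre.delta X s).isotropy ≤
        (DiffOre.semidirectToAut k n).range := by
  have hd : 1 ≤ (w l).natDegree := by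
    rw [degree_eq_natDegree (by rintro h; simp [h] at hw)] at hw
    exact_mod_cast hw
  obtain ⟨c, rfl⟩ : ∃ c, s = C c := by
    rw [degree_X, ← Nat.cast_one, Nat.cast_one, Nat.WithBot.lt_one_iff_le_zero] at hs
    exact ⟨_, eq_C_of_degree_le_zero hs⟩
  have hsymb : DiffOre.HasSymbol W l (w l) := by
    rw [hW, Finset.sum_range_succ, ← zero_add (w l)]
    refine DiffOre.HasSymbol.add ?_ (by simpa using (DiffOre.HasSymbol.poly (w l)).mul_t_pow l)
    rw [← Finset.sum_const_zero (s := Finset.range l)]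
    refine DiffOre.HasSymbol.sum fun i hi => ?_
    exact ((DiffOre.HasSymbol.poly (w i)).mul_t_pow i).of_lt (by simpa using hi)
  refine ⟨(w l).natDegree, hd, fun ρ hρ => ?_⟩
  obtain ⟨r, a, rfl⟩ := DiffOre.exists_eq_sigma_mul_tau ρ
  have ha : a ∈ rootsOfUnity (w l).natDegree k := by
    rw [mem_rootsOfUnity, Units.ext_iff]
    push_cast
    exact DiffOre.pow_natDegree_eq_one hd (DiffOre.comp_eq_of_mem_isotropy hsymb hρ)
  exact ⟨⟨.ofAdd r, ⟨a, ha⟩⟩, DiffOre.semidirectToAut_apply _ _⟩
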